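/- Throughout, $\mathbb K\in\{\mathbb R,\mathbb C\}$, Banach spaces are over $\mathbb K$, $B_X$ and $S_X$ are the closed unit ball and the unit sphere of $X$, $\mathbb T=\{\lambda\in\mathbb K:|\lambda|=1\}$, and $\mathcal L(X,Y)$ is the space of bounded linear operators. Definitions. A set $\Gamma\subseteq B_{Y^*}$ is 1-norming if $\|y\|=\sup_{y^*\in\Gamma}|y^*(y)|$ for all $y\in Y$. For $\rho\in[0,1)$, $Y$ has ACK$_\rho$ structure with corresponding 1-norming set $\Gamma$ if $\Gamma\subseteq B_{Y^*}$ is 1-norming and for every $\varepsilon>0$ and every nonempty relatively $w^*$-open $U\subseteq\Gamma$ there are $V\subseteq U$, $y_1^*\in V$, $e\in S_Y$ and $F\in\mathcal L(Y,Y)$ such that: $\|Fe\|=\|F\|=1$; $y_1^*(Fe)=1$; $F^*y_1^*=y_1^*$; $|y^*(Fe)|\le\rho$ for every $y^*\in\Gamma$ that does not satisfy $\|F^*y^*\|+(1-\varepsilon)\|y^*-F^*y^*\|\le1$; $\operatorname{dist}(F^*y^*,\operatorname{aconv}(\{0\}\cup V))<\varepsilon$ for every $y^*\in\Gamma$, where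 $\operatorname{aconv}$ is the absolutely convex hull; and $|v^*(e)-1|\le\varepsilon$ for every $v^*\in V$. An operator $T\in\mathcal L(X,Y)$ is $\Gamma$-flat if for every nonempty relatively $w^*$-open $U\subseteq\Gamma$ and every $\varepsilon>0$ there is a nonempty relatively $w^*$-open $V\subseteq\Gamma$ with $V\subseteq U$ such that $T^*(V)$ has norm diameter less than $\varepsilon$. A $\Gamma$-flat ideal is a linear subspace $\mathcal I\subseteq\mathcal L(X,Y)$ of $\Gamma$-flat operators that contains all finite rank operators and satisfies $F\circ T\in\mathcal I$ for all $T\in\mathcal I$, $F\in\mathcal L(Y,Y)$. An operator $T\in\mathcal L(X,Y)$ is Dunford-Pettis, $T\in\mathcal{DP}(X,Y)$, if it maps weakly convergent sequences to norm convergent sequences. It is range strongly exposing (RSE) if there is $x_0\in S_X$ such that every sequence $(x_n)\subseteq B_X$ with $\|Tx_n\|\to\|T\|$ has a subsequence $(x_{\sigma(n)})$ with $Tx_{\sigma(n)}\to\lambda Tx_0$ for some $\lambda\in\mathbb T$. The space $X$ has property [P$_w$] if for every $\varepsilon>0$ there is $\eta>0$ such that for all $x^*\in S_{X^*}$ and $x\in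 S_X$ with $\operatorname{Re}x^*(x)>1-\eta$ there are $y^*\in S_{X^*}$ and $y\in S_X$ with $y^*(y)=1$, $\|x^*-y^*\|<\varepsilon$, $\|x-y\|<\varepsilon$, such that $y^*$ is a smooth point of $X^*$, i.e. there is exactly one $x^{**}\in S_{X^{**}}$ with $x^{**}(y^*)=\|y^*\|$. Theorem. For every $\rho\in[0,1)$ there is a function $\eta:(0,\infty)\to(0,\infty)$ with $0<\eta(\varepsilon)<\varepsilon$ for all $\varepsilon>0$, depending only on $\rho$, with the following property. Let $X,Y$ be Banach spaces such that $Y$ has ACK$_\rho$ structure with corresponding 1-norming set $\Gamma\subseteq B_{Y^*}$, let $\mathcal I\subseteq\mathcal L(X,Y)$ be a $\Gamma$-flat ideal with $\mathcal I\subseteq\mathcal{DP}(X,Y)$, and suppose that $X$ has property [P$_w$]. Then $\mathcal I$ has the Bishop-Phelps-Bollobás property for RSE operators with the function $\eta$: for every $\varepsilon>0$, every $T\in\mathcal I$ with $\|T\|=1$ and every $x\in S_X$ with $\|Tx\|>1-\eta(\varepsilon)$, there are an RSE operator $S\in\mathcal I$ and $x_0\in S_X$ such that $\|S\|=\|Sx_0\|=1$,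 $\|S-T\|<\varepsilon$ and $\|x-x_0\|<\varepsilon$. -/

import Mathlib

open Filter Topology

namespace BPB

section Generic

/-- A point `x` of a normed space is *smooth* if there is exactly one functional of norm one that
attains the value `‖x‖` at `x`. -/
def IsSmoothPoint (𝕜 : Type*) [RCLike 𝕜] {E : Type*} [NormedAddCommGroup E] [NormedSpace 𝕜 E]
    (x : E) : Prop :=
  ∃! f : StrongDual 𝕜 E, ‖f‖ = 1 ∧ f x = ((‖x‖ : ℝ) : 𝕜)

/-- A map from a topological space to a metric space is *openly fragmented* if every nonempty open
set contains nonempty open subsets whose images have arbitrarily small diameter. -/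
def IsOpenlyFragmented {A M : Type*} [TopologicalSpace A] [PseudoMetricSpace M]
    (f : A → M) : Prop :=
  ∀ U : Set A, IsOpen U → U.Nonempty → ∀ ε : ℝ, 0 < ε →
    ∃ V : Set A, V ⊆ U ∧ IsOpen V ∧ V.Nonempty ∧ Metric.ediam (f '' V) < ENNReal.ofReal ε

end Generic

/-- Property `[P_w]` of `X`. The functional `g` attains its norm, which is one, at `y`. -/
def PropertyPw (𝕜 : Type*) [RCLike 𝕜] (X : Type*) [NormedAddCommGroup X] [NormedSpace 𝕜 X] :
    Prop :=
  ∀ ε : ℝ, 0 < ε → ∃ η : ℝ, 0 < η ∧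
    ∀ (f : StrongDual 𝕜 X) (x : X), ‖f‖ = 1 → ‖x‖ = 1 → 1 - η < RCLike.re (f x) →
      ∃ (g : StrongDual 𝕜 X) (y : X), IsSmoothPoint 𝕜 g ∧ ‖g‖ = 1 ∧ ‖y‖ = 1 ∧
        g y = 1 ∧ ‖f - g‖ < ε ∧ ‖x - y‖ < ε

section Dual

variable {𝕜 : Type*} [RCLike 𝕜] {Y : Type*} [NormedAddCommGroup Y] [NormedSpace 𝕜 Y]

/-- `Γ` is a subset of the closed dual unit ball with `‖y‖ = sup {|f y| : f ∈ Γ}` for all `y`. -/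
def IsOneNorming (Γ : Set (StrongDual 𝕜 Y)) : Prop :=
  (∀ f ∈ Γ, ‖f‖ ≤ 1) ∧ ∀ y : Y, IsLUB ((fun f : StrongDual 𝕜 Y => ‖f y‖) '' Γ) ‖y‖

/-- `U` is a subset of `Γ` that is open in `Γ` for the topology induced by the weak-star
topology. -/
def IsRelWeakStarOpen (Γ U : Set (StrongDual 𝕜 Y)) : Prop :=
  ∃ W : Set (WeakDual 𝕜 Y), IsOpen W ∧ U = Γ ∩ StrongDual.toWeakDual ⁻¹' W

/-- The absolutely convex hull of `s`, i.e. the smallest convex set containing `c • f` for all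
`f ∈ s` and all scalars `c` with `‖c‖ ≤ 1`. -/
def aconv (s : Set (StrongDual 𝕜 Y)) : Set (StrongDual 𝕜 Y) :=
  convexHull ℝ (balancedHull 𝕜 s)

/-- `Y` has `ACK_ρ` structure with the corresponding 1-norming set `Γ`. The adjoint `F*` of
`F : Y →L[𝕜] Y` acts by `F* f = f.comp F`. -/
def HasACKStructure (ρ : ℝ) (Γ : Set (StrongDual 𝕜 Y)) : Prop :=
  IsOneNorming Γ ∧
  ∀ ε : ℝ, 0 < ε → ∀ U : Set (StrongDual 𝕜 Y), IsRelWeakStarOpen Γ U → U.Nonempty →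
    ∃ (V : Set (StrongDual 𝕜 Y)) (f₁ : StrongDual 𝕜 Y) (e : Y) (F : Y →L[𝕜] Y),
      V ⊆ U ∧ f₁ ∈ V ∧ ‖e‖ = 1 ∧
      (‖F e‖ = 1 ∧ ‖F‖ = 1) ∧
      f₁ (F e) = 1 ∧
      f₁.comp F = f₁ ∧
      (∀ f ∈ Γ, ¬ ‖f.comp F‖ + (1 - ε) * ‖f - f.comp F‖ ≤ 1 → ‖f (F e)‖ ≤ ρ) ∧
      (∀ f ∈ Γ, Metric.infDist (f.comp F) (aconv (insert 0 V)) < ε) ∧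
      (∀ v ∈ V, ‖v e - 1‖ ≤ ε)

end Dual

section Operators

variable {𝕜 : Type*} [RCLike 𝕜] {X Y : Type*} [NormedAddCommGroup X] [NormedSpace 𝕜 X]
  [NormedAddCommGroup Y] [NormedSpace 𝕜 Y]

/-- `T` is `Γ`-flat: the restriction of the adjoint `T*` to `Γ`, as a map from `Γ` with the
weak-star topology to the dual of `X` with the norm, is openly fragmented. -/
def IsFlat (Γ : Set (StrongDual 𝕜 Y)) (T : X →L[𝕜] Y) : Prop :=
  IsOpenlyFragmented
    (fun f : {f : WeakDual 𝕜 Y // WeakDual.toStrongDual f ∈ Γ} =>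
      (WeakDual.toStrongDual f.1).comp T)

/-- `T` is a Dunford-Pettis operator: it maps weakly convergent sequences to norm convergent
sequences. -/
def IsDunfordPettis (T : X →L[𝕜] Y) : Prop :=
  ∀ (x : ℕ → X) (x₀ : X),
    Tendsto (fun n => toWeakSpace 𝕜 X (x n)) atTop (𝓝 (toWeakSpace 𝕜 X x₀)) →
      ∃ y : Y, Tendsto (fun n => T (x n)) atTop (𝓝 y)

/-- `I` is a `Γ`-flat ideal: a linear subspace of `Γ`-flat operators that contains the finite rank
operators and is stable under composition on the left with operators on `Y`. -/
structure IsFlatIdeal (Γ : Set (StrongDual 𝕜 Y)) (I : Submodule 𝕜 (X →L[𝕜] Y)) : Prop where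
  flat : ∀ T ∈ I, IsFlat Γ T
  finiteRank : ∀ T : X →L[𝕜] Y, FiniteDimensional 𝕜 (LinearMap.range (T : X →ₗ[𝕜] Y)) → T ∈ I
  comp_mem : ∀ T ∈ I, ∀ F : Y →L[𝕜] Y, F.comp T ∈ I

/-- `T` is range strongly exposing. -/
def IsRSE (T : X →L[𝕜] Y) : Prop :=
  ∃ x₀ : X, ‖x₀‖ = 1 ∧ ∀ x : ℕ → X, (∀ n, ‖x n‖ ≤ 1) →
    Tendsto (fun n => ‖T (x n)‖) atTop (𝓝 ‖T‖) →
      ∃ (σ : ℕ → ℕ) (c : 𝕜), StrictMono σ ∧ ‖c‖ = 1 ∧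
        Tendsto (fun n => T (x (σ n))) atTop (𝓝 (c • T x₀))

/-- The subspace `I` of operators satisfies the Bishop-Phelps-Bollobás property for range strongly
exposing operators with the function `η`. -/
def HasBPBpRSEWith (I : Submodule 𝕜 (X →L[𝕜] Y)) (η : ℝ → ℝ) : Prop :=
  ∀ ε : ℝ, 0 < ε → 0 < η ε ∧ η ε < ε ∧
    ∀ T ∈ I, ‖T‖ = 1 → ∀ x : X, ‖x‖ = 1 → 1 - η ε < ‖T x‖ →
      ∃ S ∈ I, IsRSE S ∧ ∃ x₀ : X, ‖x₀‖ = 1 ∧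
        ‖S‖ = 1 ∧ ‖S x₀‖ = 1 ∧ ‖S - T‖ < ε ∧ ‖x - x₀‖ < ε

end Operators

end BPB

/-! Flatness gives a relatively weak-star open `U ⊆ Γ` on which `T*` is nearly constant, close to a
multiple `c • g` of a functional attaining its norm at some `y` near `x`; [P_w] makes `g` a smooth
point (`IsFlat.exists_forall_norm_comp_sub_le`). The ACK data for `U` then yield `S x = c g(x) F e +
(1 - t)(T - F T) x`, a finite rank operator plus an element of the ideal. It is close to `T` because
`F T` is close to the rank one term (`norm_comp_sub_smul_le_of_infDist_aconv_lt`), and `‖S x‖ ≤ max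
|g x| q` on the unit ball with `q < 1` (`exists_isRSE_of_ack`). So `S` nearly attains its norm only
where `|g|` is nearly one; smoothness of `g` gives weak convergence along a subsequence, and the
Dunford-Pettis property makes the images converge in norm (`IsDunfordPettis.isRSE`). -/

namespace BPB

/-! ### Ekeland's principle and the Bishop-Phelps-Bollobás theorem -/

/-- Ekeland's variational principle, for the maximum of a continuous function. -/
theorem exists_ekeland_point {α : Type*} [MetricSpace α] [CompleteSpace α] {φ : α → ℝ}
    (hφ : Continuous φ) {M : ℝ} (hM : ∀ u, φ u ≤ M) {k : ℝ} (hk : 0 < k) (x : α) :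
    ∃ y, k * dist x y ≤ φ y - φ x ∧ ∀ u, φ u ≤ φ y + k * dist y u := by
  -- Order points by `a ≤ u` when `k * dist a u ≤ φ u - φ a`; choose `b ≥ a` whose value is within
  -- `2⁻ⁿ` of the supremum above `a`.
  have step : ∀ (n : ℕ) (a : α), ∃ b, k * dist a b ≤ φ b - φ a ∧
      ∀ u, k * dist a u ≤ φ u - φ a → φ u ≤ φ b + (1 / 2 : ℝ) ^ n := by
    intro n a
    have hne : (φ '' {u | k * dist a u ≤ φ u - φ a}).Nonempty := ⟨φ a, a, by simp, rfl⟩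
    have hbdd : BddAbove (φ '' {u | k * dist a u ≤ φ u - φ a}) :=
      ⟨M, by rintro _ ⟨u, -, rfl⟩; exact hM u⟩
    obtain ⟨_, ⟨b, hb, rfl⟩, hlt⟩ := exists_lt_of_lt_csSup hne
      (sub_lt_self _ (show (0 : ℝ) < (1 / 2 : ℝ) ^ n by positivity))
    exact ⟨b, hb, fun u hu => by linarith [le_csSup hbdd ⟨u, hu, rfl⟩]⟩
  choose next h₁ h₂ using step
  let s : ℕ → α := fun n => Nat.rec x next n
  have hs : ∀ n, s (n + 1) = next n (s n) := fun n => rfl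
  have hmono : ∀ n m, n ≤ m → k * dist (s n) (s m) ≤ φ (s m) - φ (s n) := by
    intro n m hnm
    induction m, hnm using Nat.le_induction with
    | base => simp
    | succ m _ ih =>
      have h := h₁ m (s m)
      rw [← hs] at h
      nlinarith [dist_triangle (s n) (s m) (s (m + 1))]
  have hφmono : Monotone (fun n => φ (s n)) := fun n m hnm => by
    have := hmono n m hnm
    have := mul_nonneg hk.le (dist_nonneg (x := s n) (y := s m))
    simp only
    linarith
  have hlim := tendsto_atTop_ciSup hφmono ⟨M, by rintro _ ⟨n, rfl⟩; exact hM _⟩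
  have hcauchy : CauchySeq s := by
    rw [Metric.cauchySeq_iff']
    intro ε hε
    obtain ⟨N, hN⟩ := Metric.cauchySeq_iff'.1 hlim.cauchySeq (k * ε) (by positivity)
    refine ⟨N, fun n hn => ?_⟩
    have h1 := hmono N n hn
    have h2 := hN n hn
    rw [Real.dist_eq] at h2
    rw [dist_comm]
    exact lt_of_mul_lt_mul_left (h1.trans_lt ((le_abs_self _).trans_lt h2)) hk.le
  obtain ⟨y, hy⟩ := cauchySeq_tendsto_of_complete hcauchy
  have hφy : Tendsto (fun n => φ (s n)) atTop (𝓝 (φ y)) := (hφ.tendsto y).comp hy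
  have hsy : ∀ n, k * dist (s n) y ≤ φ y - φ (s n) := fun n =>
    le_of_tendsto_of_tendsto ((tendsto_const_nhds.dist hy).const_mul k)
      (hφy.sub tendsto_const_nhds) (eventually_atTop.2 ⟨n, fun m hm => hmono n m hm⟩)
  refine ⟨y, hsy 0, fun u => ?_⟩
  -- A violating `u` lies above `y`, hence above every `s n`, so the near-maximal choices force `φ u
  -- ≤ φ y`.
  by_contra! hu
  have hpow : Tendsto (fun n : ℕ => (1 / 2 : ℝ) ^ n) atTop (𝓝 0) :=
    tendsto_pow_atTop_nhds_zero_of_lt_one (by norm_num) (by norm_num)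
  have hle : φ u ≤ φ y + 0 := by
    refine ge_of_tendsto ((hφy.comp (tendsto_add_atTop_nat 1)).add hpow)
      (Eventually.of_forall fun n => h₂ n (s n) u ?_)
    have := hsy n
    nlinarith [dist_triangle (s n) y u]
  have := mul_nonneg hk.le (dist_nonneg (x := y) (y := u))
  linarith

/-- If a functional `f` lies below the cone `f y + k * ‖u - y‖` on a convex set, a perturbation
of `f` of norm at most `k` attains its maximum over the set at `y`. -/
theorem exists_norm_le_forall_add_le {X : Type*} [NormedAddCommGroup X] [NormedSpace ℝ X]
    {C : Set X} (hC : Convex ℝ C) (f : StrongDual ℝ X) {k : ℝ} (hk : 0 ≤ k) {y : X} (hy : y ∈ C)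
    (h : ∀ u ∈ C, f u ≤ f y + k * ‖u - y‖) :
    ∃ φ : StrongDual ℝ X, ‖φ‖ ≤ k ∧ ∀ u ∈ C, (f + φ) u ≤ (f + φ) y := by
  have hcv : ConvexOn ℝ Set.univ fun u : X => k * ‖u - y‖ := by
    have := ((convexOn_univ_norm (E := X)).translate_left (-y)).smul hk
    simpa [Function.comp_def, sub_eq_add_neg] using this
  have hs₁ : Convex ℝ {p : X × ℝ | k * ‖p.1 - y‖ < p.2} := by
    simpa using hcv.convex_strict_epigraph
  have hs₂ : IsOpen {p : X × ℝ | k * ‖p.1 - y‖ < p.2} := isOpen_lt (by fun_prop) (by fun_prop)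
  have ht : Convex ℝ {p : X × ℝ | p.1 ∈ C ∧ p.2 ≤ f p.1 - f y} := by
    rintro p ⟨hp, hp'⟩ q ⟨hq, hq'⟩ a b ha hb hab
    refine ⟨hC hp hq ha hb hab, ?_⟩
    have hby : f y = a * f y + b * f y := by rw [← add_mul, hab, one_mul]
    simp only [Prod.fst_add, Prod.snd_add, Prod.smul_fst, Prod.smul_snd, map_add, map_smul,
      smul_eq_mul]
    nlinarith [mul_le_mul_of_nonneg_left hp' ha, mul_le_mul_of_nonneg_left hq' hb]
  have hdisj : Disjoint {p : X × ℝ | k * ‖p.1 - y‖ < p.2}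
      {p : X × ℝ | p.1 ∈ C ∧ p.2 ≤ f p.1 - f y} := by
    rw [Set.disjoint_left]
    rintro p hp ⟨hq, hq'⟩
    have := h p.1 hq
    simp only [Set.mem_ofPred_eq] at hp
    linarith
  obtain ⟨F, c, hF₁, hF₂⟩ := geometric_hahn_banach_open hs₁ hs₂ ht hdisj
  have hFy : c ≤ F (y, 0) := hF₂ _ ⟨hy, by simp⟩
  have hsplit : ∀ (u : X) (t : ℝ), F (u, t) = F (y, 0) + F (u - y, 0) + t * F (0, 1) := by
    intro u t
    have : ((u, t) : X × ℝ) = (y, 0) + (u - y, 0) + t • (0, 1) := by ext <;> simp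
    rw [this]
    simp only [map_add, map_smul, smul_eq_mul]
  -- The separating hyperplane is not vertical, so it is the graph of an affine function between `f
  -- - f y` on `C` and the cone; `φ` is minus its slope.
  have hneg : F (0, 1) < 0 := by
    have := hF₁ (y, 1) (by simp)
    rw [hsplit] at this
    have h0 : F ((y - y : X), (0 : ℝ)) = 0 := by rw [sub_self]; exact map_zero F
    linarith
  have hlow : ∀ w : X, F (w, 0) ≤ k * ‖w‖ * -F (0, 1) := by
    intro w
    refine le_of_forall_pos_le_add fun ε hε => ?_
    have := hF₁ (y + w, k * ‖w‖ + ε / -F (0, 1)) (by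
      have := div_pos hε (neg_pos.2 hneg)
      simpa)
    rw [hsplit, add_sub_cancel_left] at this
    have h2 : ε / -F (0, 1) * F (0, 1) = -ε := by
      field_simp [hneg.ne]
    nlinarith
  have hup : ∀ u ∈ C, c ≤ F (y, 0) + F (u - y, 0) + (f u - f y) * F (0, 1) := fun u hu => by
    rw [← hsplit]
    exact hF₂ _ ⟨hu, le_rfl⟩
  have hFy' : F (y, 0) ≤ c := by
    refine le_of_forall_pos_le_add fun ε hε => ?_
    have := hF₁ (y, ε / -F (0, 1)) (by
      have := div_pos hε (neg_pos.2 hneg)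
      simpa)
    have h2 : ε / -F (0, 1) * F (0, 1) = -ε := by
      field_simp [hneg.ne]
    rw [hsplit, h2] at this
    have h0 : F ((y - y : X), (0 : ℝ)) = 0 := by rw [sub_self]; exact map_zero F
    linarith
  set a := -F (0, 1) with ha
  have hapos : 0 < a := neg_pos.2 hneg
  let φ : StrongDual ℝ X := -(a⁻¹ • F.comp (ContinuousLinearMap.inl ℝ X ℝ))
  have hφ : ∀ w, φ w = -(a⁻¹ * F (w, 0)) := fun w => rfl
  have hbound : ∀ w, -(k * ‖w‖) ≤ φ w := fun w => by
    rw [hφ, neg_le_neg_iff, inv_mul_le_iff₀ hapos]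
    linarith [hlow w]
  refine ⟨φ, ContinuousLinearMap.opNorm_le_bound _ hk fun w => ?_, fun u hu => ?_⟩
  · rw [Real.norm_eq_abs, abs_le]
    refine ⟨hbound w, ?_⟩
    have := hbound (-w)
    rw [map_neg, norm_neg] at this
    linarith
  · have h1 := hup u hu
    have h2 : φ u - φ y = -(a⁻¹ * F (u - y, 0)) := by rw [← map_sub, hφ]
    have h3 : f u - f y ≤ a⁻¹ * F (u - y, 0) := by
      rw [le_inv_mul_iff₀ hapos, ha]
      linarith
    simp only [add_apply]
    linarith

/-- A real functional almost attaining its supremum over the unit ball at `x` is close to one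
attaining it at a point close to `x`. -/
theorem exists_norm_le_forall_closedBall_add_le {X : Type*} [NormedAddCommGroup X]
    [NormedSpace ℝ X] [CompleteSpace X] (f : StrongDual ℝ X) (hf : ‖f‖ ≤ 1) {k : ℝ} (hk : 0 < k)
    {x : X} (hx : ‖x‖ ≤ 1) (hfx : 1 - k ^ 2 ≤ f x) :
    ∃ (φ : StrongDual ℝ X) (y : X), ‖φ‖ ≤ k ∧ ‖y‖ ≤ 1 ∧ ‖x - y‖ ≤ k ∧
      ∀ u, ‖u‖ ≤ 1 → (f + φ) u ≤ (f + φ) y := by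
  have hbd : ∀ u : X, ‖u‖ ≤ 1 → f u ≤ 1 := fun u hu =>
    (le_abs_self _).trans (f.le_of_opNorm_le_of_le hf hu |>.trans (by norm_num))
  have : CompleteSpace (Metric.closedBall (0 : X) 1) := Metric.isClosed_closedBall.completeSpace_coe
  obtain ⟨⟨y, hy⟩, h₁, h₂⟩ := exists_ekeland_point
    (φ := fun u : Metric.closedBall (0 : X) 1 => f u) (by fun_prop) (M := 1)
    (fun u => hbd u (mem_closedBall_zero_iff.1 u.2)) hk ⟨x, by simpa using hx⟩
  have hy1 : ‖y‖ ≤ 1 := by simpa using hy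
  obtain ⟨φ, hφ, h⟩ := exists_norm_le_forall_add_le (convex_closedBall (0 : X) 1) f hk.le hy
    fun u hu => by
      have := h₂ ⟨u, hu⟩
      rwa [Subtype.dist_eq, dist_comm, dist_eq_norm] at this
  refine ⟨φ, y, hφ, hy1, ?_, fun u hu => h u (by simpa using hu)⟩
  rw [Subtype.dist_eq, dist_eq_norm] at h₁
  have := hbd y hy1
  simp only at h₁
  -- `k * ‖x - y‖ ≤ f y - f x ≤ 1 - (1 - k ^ 2)`.
  nlinarith

/-- The Bishop-Phelps-Bollobás theorem. -/
theorem bishop_phelps_bollobas {𝕜 : Type*} [RCLike 𝕜] {X : Type*} [NormedAddCommGroup X]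
    [NormedSpace 𝕜 X] [CompleteSpace X] {f : StrongDual 𝕜 X} (hf : ‖f‖ = 1) {x : X}
    (hx : ‖x‖ ≤ 1) {k : ℝ} (hk : 0 < k) (hk1 : k < 1) (hfx : 1 - k ^ 2 ≤ RCLike.re (f x)) :
    ∃ (g : StrongDual 𝕜 X) (y : X), ‖g‖ = 1 ∧ ‖y‖ = 1 ∧ g y = 1 ∧ ‖f - g‖ ≤ 2 * k ∧
      ‖x - y‖ ≤ k := by
  let _ := NormedSpace.restrictScalars ℝ 𝕜 X
  have : IsScalarTower ℝ 𝕜 X := IsScalarTower.of_algebraMap_smul fun _ _ => rfl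
  let fr : StrongDual ℝ X := RCLike.reCLM.comp (f.restrictScalars ℝ)
  have hfr : ‖fr‖ ≤ 1 := by
    refine ContinuousLinearMap.opNorm_le_bound _ zero_le_one fun u => ?_
    refine (RCLike.abs_re_le_norm (f u)).trans ?_
    simpa [hf] using f.le_opNorm u
  obtain ⟨φ, y, hφ, hy, hxy, hmax⟩ :=
    exists_norm_le_forall_closedBall_add_le fr hfr hk hx hfx
  set G : StrongDual 𝕜 X := f + φ.extendRCLike with hG
  have hre : ∀ u, RCLike.re (G u) = (fr + φ) u := fun u => by
    simp [hG, fr]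
  have hφ' : ‖(φ.extendRCLike : StrongDual 𝕜 X)‖ ≤ k := by
    rwa [StrongDual.norm_extendRCLike]
  have hdist : ‖f - G‖ ≤ k := by simpa [hG] using hφ'
  have hGnorm : |‖G‖ - 1| ≤ k := by
    rw [← hf, abs_sub_comm]
    exact (abs_norm_sub_norm_le f G).trans hdist
  have hGpos : 0 < ‖G‖ := by linarith [(abs_le.1 hGnorm).1]
  -- The ball is invariant under rotations, so the maximum of `re G` over it is `‖G‖`.
  have hbound : ‖G‖ ≤ RCLike.re (G y) := by
    have h0 : 0 ≤ RCLike.re (G y) := by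
      have := hmax 0 (by simp)
      rw [← hre, ← hre] at this
      simpa using this
    refine ContinuousLinearMap.opNorm_le_of_unit_norm h0 fun u hu => ?_
    obtain ⟨c, hc, hcu⟩ : ∃ c : 𝕜, ‖c‖ = 1 ∧ c * G u = (‖G u‖ : 𝕜) := by
      obtain ⟨c, hc, h⟩ := RCLike.exists_norm_eq_mul_self (G u)
      exact ⟨c, hc, h.symm⟩
    have := hmax (c • u) (by rw [norm_smul, hc, hu, one_mul])
    rw [← hre, ← hre, map_smul, smul_eq_mul, hcu, RCLike.ofReal_re] at this
    exact this
  have hGy : G y = (‖G‖ : 𝕜) := by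
    have h1 : ‖G y‖ ≤ ‖G‖ := by simpa using G.le_of_opNorm_le_of_le le_rfl hy
    have h2 : RCLike.re (G y) = ‖G y‖ :=
      le_antisymm (RCLike.re_le_norm _) (h1.trans hbound)
    have h3 : ‖G y‖ = ‖G‖ := le_antisymm h1 (hbound.trans (RCLike.re_le_norm _))
    rw [← h3]
    exact RCLike.norm_le_re_iff_eq_norm.1 h2.ge
  have hy1 : ‖y‖ = 1 := by
    refine le_antisymm hy ?_
    have h := G.le_opNorm y
    rw [hGy, RCLike.norm_ofReal, abs_of_pos hGpos] at h
    nlinarith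
  have hGne : (‖G‖ : 𝕜) ≠ 0 := by exact_mod_cast hGpos.ne'
  refine ⟨(‖G‖ : 𝕜)⁻¹ • G, y, ?_, hy1, ?_, ?_, hxy⟩
  · rw [norm_smul, norm_inv, RCLike.norm_ofReal, abs_of_pos hGpos, inv_mul_cancel₀ hGpos.ne']
  · rw [smul_apply, hGy, smul_eq_mul, inv_mul_cancel₀ hGne]
  -- Normalising `G` costs a second `k`.
  · have h1 : ‖G - (‖G‖ : 𝕜)⁻¹ • G‖ ≤ k := by
      have : G - (‖G‖ : 𝕜)⁻¹ • G = ((‖G‖ - 1 : ℝ) : 𝕜) • ((‖G‖ : 𝕜)⁻¹ • G) := by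
        ext u
        simp only [sub_apply, smul_apply, smul_eq_mul, RCLike.ofReal_sub, RCLike.ofReal_one]
        field_simp
      rw [this, norm_smul, norm_smul, norm_inv, RCLike.norm_ofReal, RCLike.norm_ofReal,
        abs_of_pos hGpos, inv_mul_cancel₀ hGpos.ne', mul_one]
      exact hGnorm
    calc ‖f - (‖G‖ : 𝕜)⁻¹ • G‖ = ‖(f - G) + (G - (‖G‖ : 𝕜)⁻¹ • G)‖ := by congr 1; abel
      _ ≤ 2 * k := (norm_add_le _ _).trans (by linarith)

/-! ### Smooth points of the dual and weak convergence -/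

/-- If the norm one functional `g` is a smooth point of the dual that attains its norm at `y`,
sequences in the unit ball on which `g` tends to a unimodular scalar `c` tend weakly to `c • y`. -/
theorem IsSmoothPoint.tendsto_toWeakSpace {𝕜 : Type*} [RCLike 𝕜] {X : Type*}
    [NormedAddCommGroup X] [NormedSpace 𝕜 X] {g : StrongDual 𝕜 X} (hg : IsSmoothPoint 𝕜 g)
    (hg1 : ‖g‖ = 1) {y : X} (hy : ‖y‖ = 1) (hgy : g y = 1) {x : ℕ → X} (hx : ∀ n, ‖x n‖ ≤ 1)
    {c : 𝕜} (hc : ‖c‖ = 1) (hlim : Tendsto (fun n => g (x n)) atTop (𝓝 c)) :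
    Tendsto (fun n => toWeakSpace 𝕜 X (x n)) atTop (𝓝 (toWeakSpace 𝕜 X (c • y))) := by
  have hc0 : c ≠ 0 := fun h => by simp [h] at hc
  rw [(NormedSpace.isEmbedding_inclusionInDoubleDualWeak 𝕜 X).tendsto_nhds_iff]
  -- In the weak-star compact bidual ball, every cluster point `p` has `p g = c`; by smoothness `c⁻¹
  -- • p` is the canonical image of `y`.
  refine (WeakDual.isCompact_closedBall (𝕜 := 𝕜) (0 : StrongDual 𝕜 (StrongDual 𝕜 X)) 1
    ).tendsto_nhds_of_unique_mapClusterPt (Eventually.of_forall fun n => ?_) fun p hp hcl => ?_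
  · have := (NormedSpace.inclusionInDoubleDualLi (E := X) 𝕜).norm_map (x n)
    have h2 : ‖NormedSpace.inclusionInDoubleDual 𝕜 X (x n)‖ ≤ 1 := this.le.trans (hx n)
    rw [Set.mem_preimage, mem_closedBall_zero_iff]
    exact h2
  · have hp1 : ‖WeakDual.toStrongDual p‖ ≤ 1 := by
      simpa using hp
    have hpg : p g = c := by
      have h1 := hcl.continuousAt_comp (WeakDual.eval_continuous g).continuousAt
      have h2 : (𝓝 (p g) ⊓ 𝓝 c).NeBot := by
        refine NeBot.mono h1 (inf_le_inf_left _ hlim)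
      exact eq_of_nhds_neBot h2
    obtain ⟨_, -, huniq⟩ := hg
    have e1 := huniq (c⁻¹ • WeakDual.toStrongDual p) ?_
    have e2 := huniq (NormedSpace.inclusionInDoubleDual 𝕜 X y) ?_
    · have e3 : WeakDual.toStrongDual p = c • NormedSpace.inclusionInDoubleDual 𝕜 X y := by
        rw [e2, ← e1, smul_inv_smul₀ hc0]
      refine DFunLike.ext _ _ fun h => ?_
      have := congrArg (fun q : StrongDual 𝕜 (StrongDual 𝕜 X) => q h) e3
      exact this.trans (h.map_smul c y).symm
    · exact ⟨((NormedSpace.inclusionInDoubleDualLi (E := X) 𝕜).norm_map y).trans hy, by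
        simp [hg1, hgy]⟩
    · have hval : (c⁻¹ • WeakDual.toStrongDual p) g = 1 := by
        rw [smul_apply, WeakDual.toStrongDual_apply, hpg, smul_eq_mul,
          inv_mul_cancel₀ hc0]
      refine ⟨le_antisymm ?_ ?_, by rw [hval, hg1]; simp⟩
      · rw [norm_smul, norm_inv, hc, inv_one, one_mul]
        exact hp1
      · have := (c⁻¹ • WeakDual.toStrongDual p).le_opNorm g
        rwa [hval, hg1, norm_one, mul_one] at this

/-! ### Flat operators and absolutely convex hulls -/

section

variable {𝕜 : Type*} [RCLike 𝕜] {X Y : Type*} [NormedAddCommGroup X] [NormedSpace 𝕜 X]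
  [NormedAddCommGroup Y] [NormedSpace 𝕜 Y]

theorem IsOneNorming.norm_le {Γ : Set (StrongDual 𝕜 Y)} (hΓ : IsOneNorming Γ) {y : Y} {C : ℝ}
    (h : ∀ z ∈ Γ, ‖z y‖ ≤ C) : ‖y‖ ≤ C :=
  (hΓ.2 y).2 (by rintro _ ⟨z, hz, rfl⟩; exact h z hz)

/-- If a flat operator `T` almost attains its norm at `x`, its adjoint maps a nonempty relatively
weak-star open subset of `Γ` close to a single norm attaining functional. -/
theorem IsFlat.exists_forall_norm_comp_sub_le [CompleteSpace X] {Γ : Set (StrongDual 𝕜 Y)}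
    (hΓ : IsOneNorming Γ) (hX : PropertyPw 𝕜 X) {T : X →L[𝕜] Y} (hflat : IsFlat Γ T)
    (hT : ‖T‖ = 1) {x : X} (hx : ‖x‖ = 1) {τ : ℝ} (hτ : 0 < τ) (hτ1 : τ < 1)
    (hTx : 1 - (τ / 2) ^ 2 < ‖T x‖) :
    ∃ (U : Set (StrongDual 𝕜 Y)) (g : StrongDual 𝕜 X) (y : X) (c : 𝕜),
      IsRelWeakStarOpen Γ U ∧ U.Nonempty ∧ IsSmoothPoint 𝕜 g ∧ ‖g‖ = 1 ∧ ‖y‖ = 1 ∧ g y = 1 ∧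
      ‖c‖ = 1 ∧ ‖x - y‖ < 2 * τ ∧ ∀ v ∈ U, ‖v.comp T - c • g‖ ≤ 4 * τ := by
  obtain ⟨_, ⟨z, hz, rfl⟩, hzx⟩ := (lt_isLUB_iff (hΓ.2 (T x))).1 hTx
  have hopen : IsOpen {f : {f : WeakDual 𝕜 Y // WeakDual.toStrongDual f ∈ Γ} |
      1 - (τ / 2) ^ 2 < ‖f.1 (T x)‖} :=
    isOpen_lt continuous_const
      ((WeakDual.eval_continuous (T x)).comp continuous_subtype_val).norm
  obtain ⟨V, hVU, hVopen, ⟨v₀, hv₀⟩, hdiam⟩ := hflat _ hopen ⟨⟨StrongDual.toWeakDual z, hz⟩, hzx⟩ τ hτ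
  obtain ⟨W, hW, rfl⟩ := isOpen_induced_iff.1 hVopen
  set w : StrongDual 𝕜 X := (WeakDual.toStrongDual v₀.1).comp T with hw
  have hwx : 1 - (τ / 2) ^ 2 < ‖w x‖ := hVU hv₀
  have hw1 : ‖w‖ ≤ 1 := by
    refine ((WeakDual.toStrongDual v₀.1).opNorm_comp_le T).trans ?_
    rw [hT, mul_one]
    exact hΓ.1 _ v₀.2
  have hwx' : ‖w x‖ ≤ ‖w‖ := by simpa [hx] using w.le_opNorm x
  have hwpos : 0 < ‖w‖ := by nlinarith
  have hwne : (‖w‖ : 𝕜) ≠ 0 := by exact_mod_cast hwpos.ne'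
  obtain ⟨c, hc, hcx⟩ := RCLike.exists_norm_eq_mul_self (w x)
  have hc0 : c ≠ 0 := fun h => by simp [h] at hc
  set f : StrongDual 𝕜 X := (c * (‖w‖ : 𝕜)⁻¹) • w with hf
  have hf1 : ‖f‖ = 1 := by
    rw [hf, norm_smul, norm_mul, hc, norm_inv, RCLike.norm_ofReal, abs_of_pos hwpos, one_mul,
      inv_mul_cancel₀ hwpos.ne']
  have hfx : 1 - (τ / 2) ^ 2 ≤ RCLike.re (f x) := by
    have : f x = ((‖w‖⁻¹ * ‖w x‖ : ℝ) : 𝕜) := by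
      rw [hf, smul_apply, smul_eq_mul, RCLike.ofReal_mul, hcx, RCLike.ofReal_inv]
      ring
    rw [this, RCLike.ofReal_re]
    refine hwx.le.trans (le_mul_of_one_le_left (norm_nonneg _) ?_)
    exact (one_le_inv₀ hwpos).2 hw1
  -- Passing first to an exactly norm attaining pair makes [P_w] applicable whatever its `η`, so the
  -- final modulus does not depend on `X`.
  obtain ⟨g₁, y₁, hg₁, hy₁, hgy₁, hfg₁, hxy₁⟩ :=
    bishop_phelps_bollobas hf1 hx.le (half_pos hτ) (by linarith) hfx
  obtain ⟨η, hη, hP⟩ := hX τ hτ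
  obtain ⟨g, y, hsm, hg, hy, hgy, hgg, hyy⟩ := hP g₁ y₁ hg₁ hy₁ (by simpa [hgy₁] using hη)
  refine ⟨Γ ∩ StrongDual.toWeakDual ⁻¹' W, g, y, c⁻¹, ⟨W, hW, rfl⟩,
    ⟨WeakDual.toStrongDual v₀.1, v₀.2, hv₀⟩, hsm, hg, hy, hgy, by rw [norm_inv, hc, inv_one], ?_,
    fun v hv => ?_⟩
  · linarith [norm_sub_le_norm_sub_add_norm_sub x y₁ y]
  · have h1 : ‖v.comp T - w‖ ≤ τ := by
      have hmem : v.comp T ∈ (fun f : {f : WeakDual 𝕜 Y // WeakDual.toStrongDual f ∈ Γ} =>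
          (WeakDual.toStrongDual f.1).comp T) '' (Subtype.val ⁻¹' W) :=
        ⟨⟨StrongDual.toWeakDual v, hv.1⟩, hv.2, rfl⟩
      have := (Metric.edist_le_ediam_of_mem hmem ⟨v₀, hv₀, rfl⟩).trans hdiam.le
      rw [edist_dist, ENNReal.ofReal_le_ofReal_iff hτ.le, dist_eq_norm] at this
      exact this
    have h2 : ‖w - c⁻¹ • f‖ ≤ τ := by
      have : w - c⁻¹ • f = (((1 - ‖w‖⁻¹ : ℝ)) : 𝕜) • w := by
        rw [hf, smul_smul, inv_mul_cancel_left₀ hc0]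
        ext u
        simp only [sub_apply, smul_apply, smul_eq_mul, RCLike.ofReal_sub, RCLike.ofReal_one,
          RCLike.ofReal_inv]
        ring
      rw [this, norm_smul, RCLike.norm_ofReal, ← abs_of_pos hwpos, ← abs_mul, abs_of_pos hwpos,
        sub_mul, inv_mul_cancel₀ hwpos.ne', abs_le]
      constructor <;> nlinarith
    have h3 : ‖c⁻¹ • f - c⁻¹ • g‖ ≤ 2 * τ := by
      have : c⁻¹ • f - c⁻¹ • g = c⁻¹ • (f - g) := by
        ext u
        simp only [sub_apply, smul_apply, smul_eq_mul]
        ring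
      rw [this, norm_smul, norm_inv, hc, inv_one, one_mul]
      linarith [norm_sub_le_norm_sub_add_norm_sub f g₁ g]
    -- `4τ`: one `τ` each for the diameter, normalising `w`, Bishop-Phelps-Bollobás and [P_w].
    linarith [norm_sub_le_norm_sub_add_norm_sub (v.comp T) w (c⁻¹ • g),
      norm_sub_le_norm_sub_add_norm_sub w (c⁻¹ • f) (c⁻¹ • g)]

/-- If `T* v` is close to `f` and `v e` is close to one for all `v ∈ V`, then `T* w` is close to
`w e • f` for all `w` close to the absolutely convex hull of `V`. -/
theorem norm_comp_sub_smul_le_of_infDist_aconv_lt {T : X →L[𝕜] Y} (hT : ‖T‖ ≤ 1)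
    {f : StrongDual 𝕜 X} (hf : ‖f‖ ≤ 1) {e : Y} (he : ‖e‖ ≤ 1) {V : Set (StrongDual 𝕜 Y)} {a b : ℝ}
    (ha : 0 ≤ a) (hb : 0 ≤ b) (hVT : ∀ v ∈ V, ‖v.comp T - f‖ ≤ a)
    (hVe : ∀ v ∈ V, ‖v e - 1‖ ≤ b) {w : StrongDual 𝕜 Y} {r : ℝ}
    (hw : Metric.infDist w (aconv (insert 0 V)) < r) : ‖w.comp T - w e • f‖ ≤ a + b + 2 * r := by
  -- `D` is linear, so its norm sublevel sets are absolutely convex; it is also 2-Lipschitz, whence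
  -- `2 * r`.
  obtain ⟨D, hD⟩ : ∃ D : StrongDual 𝕜 Y → StrongDual 𝕜 X, ∀ w, D w = w.comp T - w e • f :=
    ⟨_, fun _ => rfl⟩
  have hDx : ∀ w x, D w x = w (T x) - w e * f x := fun w x => by rw [hD]; rfl
  have hbal : Balanced 𝕜 {w | ‖D w‖ ≤ a + b} := by
    rintro c hc _ ⟨w, hw, rfl⟩
    have : D (c • w) = c • D w := by
      ext u
      simp only [hDx, smul_apply, smul_eq_mul]
      ring
    simp only [Set.mem_ofPred_eq] at hw ⊢
    rw [this, norm_smul]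
    exact (mul_le_of_le_one_left (norm_nonneg _) hc).trans hw
  have hconv : Convex ℝ {w | ‖D w‖ ≤ a + b} := by
    intro p hp q hq s t hs ht hst
    have : D (s • p + t • q) = s • D p + t • D q := by
      ext u
      simp only [hDx, add_apply, smul_apply, RCLike.real_smul_eq_coe_mul]
      ring
    simp only [Set.mem_ofPred_eq] at hp hq ⊢
    rw [this]
    refine (norm_add_le _ _).trans ?_
    rw [norm_smul, norm_smul, Real.norm_of_nonneg hs, Real.norm_of_nonneg ht]
    nlinarith [mul_le_mul_of_nonneg_left hp hs, mul_le_mul_of_nonneg_left hq ht]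
  have hsub : insert 0 V ⊆ {w | ‖D w‖ ≤ a + b} := by
    rintro v (rfl | hv)
    · have : D 0 = 0 := by
        ext u
        simp [hDx]
      simp only [Set.mem_ofPred_eq]
      rw [this, norm_zero]
      exact add_nonneg ha hb
    · have : D v = (v.comp T - f) - (v e - 1) • f := by
        ext u
        simp only [hDx, sub_apply, ContinuousLinearMap.comp_apply, smul_apply, smul_eq_mul]
        ring
      simp only [Set.mem_ofPred_eq]
      rw [this]
      refine (norm_sub_le _ _).trans (add_le_add (hVT v hv) ?_)
      rw [norm_smul]
      exact (mul_le_of_le_one_right (norm_nonneg _) hf).trans (hVe v hv)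
  have hne : (aconv (insert 0 V)).Nonempty := by
    rw [aconv, convexHull_nonempty_iff]
    exact ⟨0, mem_balancedHull_iff.2 ⟨1, norm_one.le, 0, Set.mem_insert _ _, one_smul 𝕜 _⟩⟩
  have hmin : aconv (insert 0 V) ⊆ {w | ‖D w‖ ≤ a + b} :=
    convexHull_min (hbal.balancedHull_subset_of_subset hsub) hconv
  obtain ⟨p, hp, hwp⟩ := (Metric.infDist_lt_iff hne).1 hw
  have hp' : ‖D p‖ ≤ a + b := hmin hp
  have hsplit : D w = D p + ((w - p).comp T - (w - p) e • f) := by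
    ext u
    simp only [hDx, add_apply, sub_apply, smul_apply, smul_eq_mul, ContinuousLinearMap.comp_apply]
    ring
  rw [dist_eq_norm] at hwp
  have h1 : ‖(w - p).comp T‖ ≤ ‖w - p‖ :=
    ((w - p).opNorm_comp_le T).trans (mul_le_of_le_one_right (norm_nonneg _) hT)
  have h2 : ‖(w - p) e • f‖ ≤ ‖w - p‖ := by
    rw [norm_smul]
    exact (mul_le_of_le_one_right (norm_nonneg _) hf).trans
      (((w - p).le_opNorm e).trans (mul_le_of_le_one_right (norm_nonneg _) he))
  rw [← hD]
  calc ‖D w‖ ≤ ‖D p‖ + (‖(w - p).comp T‖ + ‖(w - p) e • f‖) := by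
        rw [hsplit]
        exact (norm_add_le _ _).trans (by gcongr; exact norm_sub_le _ _)
    _ ≤ a + b + 2 * r := by linarith

/-! ### Range strong exposure and the approximating operator -/

/-- A Dunford-Pettis operator of norm one dominated on the unit ball by the maximum of a constant
less than one and of a smooth norm attaining functional is range strongly exposing. -/
theorem IsDunfordPettis.isRSE {S : X →L[𝕜] Y} (hDP : IsDunfordPettis S) (hS : ‖S‖ = 1)
    {g : StrongDual 𝕜 X} (hg : IsSmoothPoint 𝕜 g) (hg1 : ‖g‖ = 1) {y : X} (hy : ‖y‖ = 1)
    (hgy : g y = 1) {q : ℝ} (hq : q < 1) (hbound : ∀ x, ‖x‖ ≤ 1 → ‖S x‖ ≤ max ‖g x‖ q) :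
    IsRSE S := by
  refine ⟨y, hy, fun x hx hlim => ?_⟩
  rw [hS] at hlim
  have hgx : ∀ n, ‖g (x n)‖ ≤ 1 := fun n => by
    simpa using g.le_of_opNorm_le_of_le hg1.le (hx n)
  have hnorm : Tendsto (fun n => ‖g (x n)‖) atTop (𝓝 1) := by
    refine tendsto_of_tendsto_of_tendsto_of_le_of_le' hlim tendsto_const_nhds ?_
      (Eventually.of_forall hgx)
    filter_upwards [hlim.eventually (lt_mem_nhds hq)] with n hn
    exact (le_max_iff.1 (hbound _ (hx n))).resolve_right (not_le.2 hn)
  obtain ⟨c, -, σ, hσ, hc⟩ := (isCompact_closedBall (0 : 𝕜) 1).tendsto_subseq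
    (x := fun n => g (x n)) fun n => by simpa using hgx n
  have hc1 : ‖c‖ = 1 := tendsto_nhds_unique hc.norm (hnorm.comp hσ.tendsto_atTop)
  have hweak := hg.tendsto_toWeakSpace hg1 hy hgy (fun n => hx (σ n)) hc1 hc
  obtain ⟨l, hl⟩ := hDP _ _ hweak
  -- The Dunford-Pettis property only supplies some limit; weak continuity of `S` identifies it.
  have hlS : l = S (c • y) := by
    have h1 := ((toWeakSpaceCLM 𝕜 Y).continuous.tendsto l).comp hl
    have h2 := ((WeakSpace.map S).continuous.tendsto _).comp hweak
    exact (toWeakSpace 𝕜 Y).injective (tendsto_nhds_unique h1 h2)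
  refine ⟨σ, c, hσ, hc1, ?_⟩
  rwa [← map_smul, ← hlS]

/-- The approximating operator built from the `ACK_ρ` structure. -/
theorem exists_isRSE_of_ack {ρ : ℝ} {Γ : Set (StrongDual 𝕜 Y)}
    (hΓ : IsOneNorming Γ) {I : Submodule 𝕜 (X →L[𝕜] Y)} (hI : IsFlatIdeal Γ I)
    (hDP : ∀ T ∈ I, IsDunfordPettis T) {T : X →L[𝕜] Y} (hTI : T ∈ I) (hT : ‖T‖ = 1)
    {g : StrongDual 𝕜 X} (hg : IsSmoothPoint 𝕜 g) (hg1 : ‖g‖ = 1) {y : X} (hy : ‖y‖ = 1)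
    (hgy : g y = 1) {c : 𝕜} (hc : ‖c‖ = 1) {τ t : ℝ} (hτ : 0 < τ) (hτt : τ < t) (ht1 : t < 1)
    (hq : 7 * τ * (1 - t) < t * (1 - ρ))
    {V : Set (StrongDual 𝕜 Y)} {f₁ : StrongDual 𝕜 Y} {e : Y} {F : Y →L[𝕜] Y}
    (hVT : ∀ v ∈ V, ‖v.comp T - c • g‖ ≤ 4 * τ) (hf₁Γ : f₁ ∈ Γ) (he : ‖e‖ = 1)
    (hF : ‖F‖ = 1) (hf₁e : f₁ (F e) = 1) (hf₁F : f₁.comp F = f₁)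
    (hρ : ∀ f ∈ Γ, ¬ ‖f.comp F‖ + (1 - τ) * ‖f - f.comp F‖ ≤ 1 → ‖f (F e)‖ ≤ ρ)
    (hdist : ∀ f ∈ Γ, Metric.infDist (f.comp F) (aconv (insert 0 V)) < τ)
    (hVe : ∀ v ∈ V, ‖v e - 1‖ ≤ τ) :
    ∃ S ∈ I, IsRSE S ∧ ‖S‖ = 1 ∧ ‖S y‖ = 1 ∧ ‖S - T‖ ≤ 7 * τ + 2 * t := by
  have ht0 : 0 < t := hτ.trans hτt
  set f : StrongDual 𝕜 X := c • g with hf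
  have hf1 : ‖f‖ = 1 := by rw [hf, norm_smul, hc, hg1, one_mul]
  have hfx : ∀ x, ‖f x‖ = ‖g x‖ := fun x => by simp [hf, hc]
  set S : X →L[𝕜] Y := f.smulRight (F e) + ((1 - t : ℝ) : 𝕜) • (T - F.comp T) with hS
  have hzS : ∀ (z : StrongDual 𝕜 Y) (x : X),
      z (S x) = z (F e) * f x + ((1 - t : ℝ) : 𝕜) * (z - z.comp F) (T x) := fun z x => by
    simp [hS, mul_comm]
  have hnear : ∀ z ∈ Γ, ‖(z.comp F).comp T - z (F e) • f‖ ≤ 7 * τ := fun z hz => by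
    have := norm_comp_sub_smul_le_of_infDist_aconv_lt hT.le hf1.le he.le (by positivity) hτ.le
      hVT hVe (hdist z hz)
    calc _ ≤ 4 * τ + τ + 2 * τ := this
      _ = 7 * τ := by ring
  have hTx : ∀ x, ‖x‖ ≤ 1 → ‖T x‖ ≤ 1 := fun x hx => by
    simpa using T.le_of_opNorm_le_of_le hT.le hx
  have hgx : ∀ x, ‖x‖ ≤ 1 → ‖g x‖ ≤ 1 := fun x hx => by
    simpa using g.le_of_opNorm_le_of_le hg1.le hx
  have hnear' : ∀ z ∈ Γ, ∀ x, ‖x‖ ≤ 1 → ‖z (F (T x)) - z (F e) * f x‖ ≤ 7 * τ :=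
    fun z hz x hx => by
      simpa using ((z.comp F).comp T - z (F e) • f).le_of_opNorm_le_of_le (hnear z hz) hx
  have hzTx : ∀ z ∈ Γ, ∀ x, ‖x‖ ≤ 1 → ‖z (T x)‖ ≤ 1 := fun z hz x hx => by
    simpa using z.le_of_opNorm_le_of_le (hΓ.1 z hz) (hTx x hx)
  have ht1' : ‖((1 - t : ℝ) : 𝕜)‖ = 1 - t := by
    rw [RCLike.norm_ofReal, abs_of_pos (by linarith)]
  have htn : ‖(t : 𝕜)‖ = t := by rw [RCLike.norm_ofReal, abs_of_pos ht0]
  -- One entry for each alternative of the ACK condition; they are below one by `τ < t` and by `hq`.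
  set q := max ((1 - t) / (1 - τ)) (t * ρ + (1 - t) * (1 + 7 * τ)) with hqdef
  have hq1 : q < 1 := by
    refine max_lt ?_ (by nlinarith)
    rw [div_lt_one (by linarith)]
    linarith
  have hbound : ∀ x, ‖x‖ ≤ 1 → ‖S x‖ ≤ max ‖g x‖ q := fun x hx => by
    refine hΓ.norm_le fun z hz => ?_
    by_cases hcase : ‖z.comp F‖ + (1 - τ) * ‖z - z.comp F‖ ≤ 1
    · set A := ‖z.comp F‖
      set B := ‖z - z.comp F‖
      set m := max ‖g x‖ q
      have hA0 : 0 ≤ A := norm_nonneg _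
      have hB0 : 0 ≤ B := norm_nonneg _
      have hA1 : A ≤ 1 := by nlinarith
      have h1 : ‖z (F e)‖ ≤ A := by
        simpa [A] using (z.comp F).le_of_opNorm_le_of_le le_rfl he.le
      have h2 : ‖(z - z.comp F) (T x)‖ ≤ B := by
        simpa [B] using (z - z.comp F).le_of_opNorm_le_of_le le_rfl (hTx x hx)
      -- The damping `1 - t ≤ m * (1 - τ)` turns the ACK inequality into the bound `A * m + (1 - A)
      -- * m`.
      have h3 : (1 - t) * B ≤ m * (1 - A) := by
        have hm : (1 - t) / (1 - τ) ≤ m := (le_max_left _ _).trans (le_max_right _ _)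
        rw [div_le_iff₀ (by linarith)] at hm
        have hm0 : 0 ≤ m := (norm_nonneg _).trans (le_max_left _ _)
        calc (1 - t) * B ≤ m * (1 - τ) * B := mul_le_mul_of_nonneg_right hm hB0
          _ = m * ((1 - τ) * B) := by ring
          _ ≤ m * (1 - A) := mul_le_mul_of_nonneg_left (by linarith) hm0
      calc ‖z (S x)‖ ≤ ‖z (F e)‖ * ‖f x‖ + (1 - t) * ‖(z - z.comp F) (T x)‖ := by
            rw [hzS]
            refine (norm_add_le _ _).trans_eq ?_
            rw [norm_mul, norm_mul, ht1']
        _ ≤ A * m + (1 - t) * B := by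
            rw [hfx]
            gcongr
            exact le_max_left _ _
        _ ≤ m := by nlinarith
    · refine le_max_of_le_right (le_max_of_le_right ?_)
      -- Here `|z (F e)| ≤ ρ`, so weight `t` falls on a term of size at most `ρ`; the rest is `z (T
      -- x)` up to `7τ`.
      have hsplit : z (S x) = (t : 𝕜) * (z (F e) * f x) +
          ((1 - t : ℝ) : 𝕜) * (z (T x) - (z (F (T x)) - z (F e) * f x)) := by
        rw [hzS]
        simp only [sub_apply, ContinuousLinearMap.comp_apply, RCLike.ofReal_sub, RCLike.ofReal_one]
        ring
      have h1 : ‖z (F e) * f x‖ ≤ ρ := by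
        rw [norm_mul, hfx]
        exact (mul_le_of_le_one_right (norm_nonneg _) (hgx x hx)).trans (hρ z hz hcase)
      calc ‖z (S x)‖ ≤ t * ‖z (F e) * f x‖ +
            (1 - t) * ‖z (T x) - (z (F (T x)) - z (F e) * f x)‖ := by
            rw [hsplit]
            refine (norm_add_le _ _).trans_eq ?_
            rw [norm_mul, norm_mul (((1 - t : ℝ) : 𝕜)), ht1', htn]
        _ ≤ t * ρ + (1 - t) * (1 + 7 * τ) := by
            have := (norm_sub_le (z (T x)) (z (F (T x)) - z (F e) * f x)).trans
              (add_le_add (hzTx z hz x hx) (hnear' z hz x hx))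
            gcongr
  have hSle : ‖S‖ ≤ 1 := ContinuousLinearMap.opNorm_le_of_unit_norm zero_le_one fun x hx =>
    (hbound x hx.le).trans (max_le (hgx x hx.le) hq1.le)
  have hSy : 1 ≤ ‖S y‖ := by
    -- Since `F* f₁ = f₁`, the second summand of `S` vanishes under `f₁`.
    have h1 : f₁ (S y) = c := by
      rw [hzS, hf₁e, hf₁F]
      simp [hf, hgy]
    have h2 := f₁.le_of_opNorm_le (hΓ.1 f₁ hf₁Γ) (S y)
    rwa [h1, hc, one_mul] at h2
  have hSy' : ‖S y‖ ≤ ‖S‖ := by simpa [hy] using S.le_opNorm y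
  have hS1 : ‖S‖ = 1 := le_antisymm hSle (hSy.trans hSy')
  have hSI : S ∈ I := by
    refine I.add_mem (hI.finiteRank _ ?_) (I.smul_mem _ (I.sub_mem hTI (hI.comp_mem T hTI F)))
    refine Submodule.finiteDimensional_of_le (S₂ := Submodule.span 𝕜 {F e}) ?_
    rintro _ ⟨x, rfl⟩
    exact Submodule.smul_mem _ _ (Submodule.mem_span_singleton_self _)
  refine ⟨S, hSI, (hDP S hSI).isRSE hS1 hg hg1 hy hgy hq1 hbound, hS1,
    le_antisymm (hSy'.trans hSle) hSy, ?_⟩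
  refine ContinuousLinearMap.opNorm_le_of_unit_norm (by positivity) fun x hx => ?_
  refine hΓ.norm_le fun z hz => ?_
  have hsplit : z ((S - T) x) = -(z (F (T x)) - z (F e) * f x) -
      (t : 𝕜) * (z (T x) - z (F (T x))) := by
    rw [sub_apply, map_sub, hzS]
    simp only [sub_apply, ContinuousLinearMap.comp_apply, RCLike.ofReal_sub, RCLike.ofReal_one]
    ring
  have h1 : ‖z (F (T x))‖ ≤ 1 := by
    have h := F.le_of_opNorm_le_of_le hF.le (hTx x hx.le)
    rw [one_mul] at h
    simpa using z.le_of_opNorm_le_of_le (hΓ.1 z hz) h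
  have h2 : ‖z (T x) - z (F (T x))‖ ≤ 2 :=
    (norm_sub_le _ _).trans (by linarith [hzTx z hz x hx.le])
  rw [hsplit]
  refine (norm_sub_le _ _).trans ?_
  rw [norm_neg, norm_mul, htn]
  nlinarith [hnear' z hz x hx.le]

end

end BPB

/-! ### Choice of the constants -/

theorem mainTheorem8 (ρ : ℝ) (hρ0 : 0 ≤ ρ) (hρ1 : ρ < 1) :
    ∃ η : ℝ → ℝ, ∀ (𝕜 : Type*) [RCLike 𝕜]
      (X : Type*) [NormedAddCommGroup X] [NormedSpace 𝕜 X] [CompleteSpace X]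
      (Y : Type*) [NormedAddCommGroup Y] [NormedSpace 𝕜 Y] [CompleteSpace Y]
      (Γ : Set (StrongDual 𝕜 Y)) (I : Submodule 𝕜 (X →L[𝕜] Y)),
      BPB.HasACKStructure ρ Γ →
      BPB.IsFlatIdeal Γ I →
      (∀ T ∈ I, BPB.IsDunfordPettis T) →
      BPB.PropertyPw 𝕜 X →
      BPB.HasBPBpRSEWith I η := by
  -- With `δ = min ε 1`, `τ = δ(1 - ρ)/30` and `t = 7δ/30`, one has `7τ = t(1 - ρ)`, hence `hq`, and
  -- `7τ + 2t ≤ 21δ/30 < ε`. The modulus is `(τ/2)²`.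
  refine ⟨fun ε => (min ε 1 * (1 - ρ) / 30 / 2) ^ 2, ?_⟩
  intro 𝕜 _ X _ _ _ Y _ _ _ Γ I hACK hI hDP hX ε hε
  obtain ⟨δ, hδ, hδε, hδ1, hδdef⟩ : ∃ δ : ℝ, 0 < δ ∧ δ ≤ ε ∧ δ ≤ 1 ∧ min ε 1 = δ :=
    ⟨min ε 1, lt_min hε one_pos, min_le_left _ _, min_le_right _ _, rfl⟩
  simp only [hδdef]
  obtain ⟨τ, hτdef⟩ : ∃ τ : ℝ, τ = δ * (1 - ρ) / 30 := ⟨_, rfl⟩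
  have hτ : 0 < τ := by
    rw [hτdef]
    have : 0 < 1 - ρ := by linarith
    positivity
  have hτδ : τ ≤ δ / 30 := by rw [hτdef]; nlinarith
  rw [← hτdef]
  refine ⟨by positivity, by nlinarith, fun T hTI hT x hx hTx => ?_⟩
  obtain ⟨U, g, y, c, hU, hUne, hg, hg1, hy, hgy, hc, hxy, hUT⟩ :=
    (hI.flat T hTI).exists_forall_norm_comp_sub_le hACK.1 hX hT hx hτ (by linarith) hTx
  obtain ⟨V, f₁, e, F, hVU, hf₁V, he, ⟨-, hF⟩, hf₁e, hf₁F, hρ, hdist, hVe⟩ :=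
    hACK.2 τ hτ U hU hUne
  have hf₁Γ : f₁ ∈ Γ := by
    obtain ⟨W, -, rfl⟩ := hU
    exact (hVU hf₁V).1
  obtain ⟨S, hSI, hS, hS1, hSy, hST⟩ := BPB.exists_isRSE_of_ack hACK.1 hI hDP hTI hT hg hg1 hy
    hgy hc hτ (t := 7 * δ / 30) (by linarith) (by linarith)
    (by rw [hτdef]; nlinarith [mul_pos (mul_pos hδ hδ) (sub_pos.2 hρ1)])
    (fun v hv => hUT v (hVU hv)) hf₁Γ he hF hf₁e hf₁F hρ hdist hVe
  exact ⟨S, hSI, hS, y, hy, hS1, hSy, by linarith, by linarith⟩
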